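/- Let $d,n\ge 1$ and $m\ge 0$ be integers and $\Gamma=\{-m,\dots,m\}^d\subset\mathbb{Z}^d$. Let $x_1,\dots,x_n$ be i.i.d. random variables uniformly distributed on $[0,1]^d$. Let $U$ be the $n\times|\Gamma|$ matrix with entries $u_{tk}=e^{2\pi i\,k\cdot x_t}$ ($1\le t\le n$, $k\in\Gamma$), let $$V_t=\{y\in[0,1]^d:\ \|y-x_t\|_2\le\|y-x_s\|_2\ \text{for all } s\ne t\}$$ be the Voronoi region of $x_t$, let $w_t=|V_t|$ be its Lebesgue measure, let $W=\mathrm{diag}(w_1,\dots,w_n)$, and put $T^w=U^*WU$. Let $\gamma,\delta\in(0,1)$. If $$n\ \ge\ \Big(\frac{2\pi d}{\gamma\ln 2}\Big)^d m^d\,\ln\!\Big(\Big(\frac{2\pi d}{\gamma\ln 2}\Big)^d\frac{m^d}{\delta}\Big)$$ (the right-hand side being read as $0$ when $m=0$), then with probability at least $1-\delta$ the Hermitian matrix $T^w$ satisfies $\lambda_{\min}(T^w)>0$ and its condition number satisfies $$\frac{\lambda_{\max}(T^w)}{\lambda_{\min}(T^w)}\ \le\ \big(1-2^{\gamma-1}\big)^{-2}.$$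 -/

import Mathlib

open MeasureTheory ProbabilityTheory
open scoped Matrix

noncomputable section

namespace RandomSampling

/-- The frequency set `{-m, …, m}^d` in `ℤ^d`. -/
def cubeFrequencies (d m : ℕ) : Finset (Fin d → ℤ) :=
  Fintype.piFinset fun _ => Finset.Icc (-(m : ℤ)) (m : ℤ)

/-- The unit cube `[0,1]^d` in Euclidean space. -/
def unitCube (d : ℕ) : Set (EuclideanSpace ℝ (Fin d)) :=
  {y | ∀ i, y i ∈ Set.Icc (0 : ℝ) 1}

/-- The Fourier matrix with entries `u_{tk} = exp (2πi k·x_t)`, `t = 1, …, n`, `k ∈ Γ`. -/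
def fourierMatrix {d n : ℕ} (Γ : Finset (Fin d → ℤ)) (x : Fin n → EuclideanSpace ℝ (Fin d)) :
    Matrix (Fin n) Γ ℂ :=
  Matrix.of fun t k =>
    Complex.exp (2 * Real.pi * Complex.I * ((∑ i, ((k : Fin d → ℤ) i : ℝ) * x t i : ℝ) : ℂ))

/-- The Voronoi region of `x_t` in the unit cube: the points at least as close, in the Euclidean
norm, to `x_t` as to every other sampling point. -/
def voronoiRegion {d n : ℕ} (x : Fin n → EuclideanSpace ℝ (Fin d)) (t : Fin n) :
    Set (EuclideanSpace ℝ (Fin d)) :=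
  {y | y ∈ unitCube d ∧ ∀ s, s ≠ t → ‖y - x t‖ ≤ ‖y - x s‖}

/-- The Lebesgue measure of the Voronoi region of `x_t`. -/
def voronoiWeight {d n : ℕ} (x : Fin n → EuclideanSpace ℝ (Fin d)) (t : Fin n) : ℝ :=
  volume.real (voronoiRegion x t)

/-- The Voronoi-weighted matrix `T^w = U* W U`. -/
def weightedMatrix {d n : ℕ} (Γ : Finset (Fin d → ℤ)) (x : Fin n → EuclideanSpace ℝ (Fin d)) :
    Matrix Γ Γ ℂ :=
  (fourierMatrix Γ x)ᴴ * Matrix.diagonal (fun t => (voronoiWeight x t : ℂ)) * fourierMatrix Γ x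

theorem weightedMatrix_isHermitian {d n : ℕ} (Γ : Finset (Fin d → ℤ))
    (x : Fin n → EuclideanSpace ℝ (Fin d)) : (weightedMatrix Γ x).IsHermitian := by
  refine Matrix.isHermitian_conjTranspose_mul_mul _ ?_
  rw [Matrix.isHermitian_diagonal_iff]
  intro t
  exact Complex.conj_ofReal _

/-- The largest eigenvalue of a Hermitian matrix (with a nonempty index set). -/
def lambdaMax {ι : Type*} [Fintype ι] [DecidableEq ι] {A : Matrix ι ι ℂ} (hA : A.IsHermitian) : ℝ :=
  ⨆ i, hA.eigenvalues i

/-- The smallest eigenvalue of a Hermitian matrix (with a nonempty index set). -/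
def lambdaMin {ι : Type*} [Fintype ι] [DecidableEq ι] {A : Matrix ι ι ℂ} (hA : A.IsHermitian) : ℝ :=
  ⨅ i, hA.eigenvalues i

/-- The condition number `λ_max / λ_min` of a Hermitian matrix; it is meaningful when
`0 < λ_min`. -/
def conditionNumber {ι : Type*} [Fintype ι] [DecidableEq ι] {A : Matrix ι ι ℂ}
    (hA : A.IsHermitian) : ℝ :=
  lambdaMax hA / lambdaMin hA

end RandomSampling

end

noncomputable section

namespace RandomSampling

/-! Write p = ∑ c_k e^{2πi k·y}. The quadratic form of T^w at c is ∑ w_t |p(x_t)|², a Riemann sum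
over Voronoi regions for ∫|p|² = ‖c‖². Suppose every point of the cube is within r of a sample and
|k| ≤ κ on Γ; put A = e^{2πrκ} - 1 < 1.

On V_t, Taylor expansion at y and Cauchy–Schwarz over all derivatives give |p(x_t) - p(y)|² ≤ A
S(y). Here S is a Hermitian form in the terms c_k e^{2πi k·y}, and orthogonality of characters gives
∫ S ≤ A‖c‖² (`norm_sq_trigPolynomial_sub_le`, `integral_unitCube_kernelForm`). Integrating over the
V_t places the form between (1-A)²‖c‖² and (1+A)²‖c‖². Taking 2πrκ = γ ln 2, so that A = 2^γ - 1,
gives the stated bound.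

The samples must be √d/N-dense for N = 2πdm/(γ ln 2). Cut the cube into M^d cells, M = ⌈N⌉. Asking
for a sample in each cell is too costly, since the cells have volume M^{-d} and not N^{-d}. It
suffices that each cell has a sample within 1/N, coordinatewise, of all of it; such samples fill a
box with sides at least 1/N, longer in the interior directions. The extra length offsets the
rounding of N in the union bound (`sum_exp_volume_cellBox_le`). -/

/-! ### Taylor remainders of exponential sums -/

theorem dotProduct_pow_eq_sum {d : ℕ} (a b : Fin d → ℝ) (j : ℕ) :
    (a ⬝ᵥ b) ^ j = ∑ p : Fin j → Fin d, (∏ l, a (p l)) * ∏ l, b (p l) := by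
  simp only [dotProduct, Fintype.sum_pow, Finset.prod_mul_distrib]

theorem norm_sq_sum_mul_le {α : Type*} [Fintype α] (H : α → ℝ) (D : α → ℂ) :
    ‖∑ p, (H p : ℂ) * D p‖ ^ 2 ≤ (∑ p, H p ^ 2) * ∑ p, ‖D p‖ ^ 2 := by
  have h1 : ‖∑ p, (H p : ℂ) * D p‖ ≤ ∑ p, |H p| * ‖D p‖ := by
    refine (norm_sum_le _ _).trans_eq (Finset.sum_congr rfl fun p _ => ?_)
    rw [norm_mul, Complex.norm_real, Real.norm_eq_abs]
  calc _ ≤ (∑ p, |H p| * ‖D p‖) ^ 2 := by gcongr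
    _ ≤ _ := by
      simpa only [sq_abs] using
        Finset.sum_mul_sq_le_sq_mul_sq Finset.univ (fun p => |H p|) (fun p => ‖D p‖)

/-- A Hermitian form in `v` with real kernel `φ`. -/
def kernelForm {ι : Type*} [Fintype ι] (φ : ι → ι → ℝ) (v : ι → ℂ) : ℝ :=
  ∑ k, ∑ l, (v k * star (v l)).re * φ k l

theorem norm_sq_sum_eq_kernelForm {ι : Type*} [Fintype ι] (b : ι → ℝ) (v : ι → ℂ) :
    ‖∑ k, v k * (b k : ℂ)‖ ^ 2 = kernelForm (fun k l => b k * b l) v := by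
  have h : ((‖∑ k, v k * (b k : ℂ)‖ ^ 2 : ℝ) : ℂ) =
      (∑ k, v k * (b k : ℂ)) * star (∑ k, v k * (b k : ℂ)) := by
    push_cast
    exact (Complex.mul_conj' _).symm
  rw [← Complex.ofReal_re (‖∑ k, v k * (b k : ℂ)‖ ^ 2), h, star_sum, Finset.sum_mul_sum,
    kernelForm, Complex.re_sum]
  refine Finset.sum_congr rfl fun k _ => ?_
  rw [Complex.re_sum]
  refine Finset.sum_congr rfl fun l _ => ?_
  rw [← Complex.re_mul_ofReal]
  congr 1
  simp
  ring

theorem kernelForm_sum {ι α : Type*} [Fintype ι] (s : Finset α) (φ : α → ι → ι → ℝ) (v : ι → ℂ) :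
    kernelForm (fun k l => ∑ p ∈ s, φ p k l) v = ∑ p ∈ s, kernelForm (φ p) v := by
  simp only [kernelForm, Finset.mul_sum]
  rw [Finset.sum_comm (s := s)]
  refine Finset.sum_congr rfl fun k _ => ?_
  rw [Finset.sum_comm (s := s)]

theorem kernelForm_const_mul {ι : Type*} [Fintype ι] (c : ℝ) (φ : ι → ι → ℝ) (v : ι → ℂ) :
    kernelForm (fun k l => c * φ k l) v = c * kernelForm φ v := by
  simp only [kernelForm, Finset.mul_sum]
  exact Finset.sum_congr rfl fun k _ => Finset.sum_congr rfl fun l _ => by ring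

/-- Up to a constant, the right side is the squared norm of the tensor of j-th derivatives of ∑ v_k
e^{i a_k·h} at h = 0. -/
theorem kernelForm_dotProduct_pow {ι : Type*} [Fintype ι] {d : ℕ} (a : ι → Fin d → ℝ) (v : ι → ℂ)
    (j : ℕ) : kernelForm (fun k l => (a k ⬝ᵥ a l) ^ j) v =
      ∑ p : Fin j → Fin d, ‖∑ k, v k * ((∏ i, a k (p i) : ℝ) : ℂ)‖ ^ 2 := by
  simp only [dotProduct_pow_eq_sum, kernelForm_sum, norm_sq_sum_eq_kernelForm]

theorem norm_sq_sum_dotProduct_pow_le {ι : Type*} [Fintype ι] {d : ℕ} (a : ι → Fin d → ℝ)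
    (v : ι → ℂ) (h : Fin d → ℝ) (j : ℕ) :
    ‖∑ k, v k * (((a k ⬝ᵥ h) ^ j : ℝ) : ℂ)‖ ^ 2 ≤
      (h ⬝ᵥ h) ^ j * kernelForm (fun k l => (a k ⬝ᵥ a l) ^ j) v := by
  rw [kernelForm_dotProduct_pow]
  have h1 : ∑ k, v k * (((a k ⬝ᵥ h) ^ j : ℝ) : ℂ) =
      ∑ p : Fin j → Fin d, ((∏ i, h (p i) : ℝ) : ℂ) *
        ∑ k, v k * ((∏ i, a k (p i) : ℝ) : ℂ) := by
    simp only [dotProduct_pow_eq_sum, Finset.mul_sum, Complex.ofReal_sum]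
    rw [Finset.sum_comm]
    refine Finset.sum_congr rfl fun p _ => Finset.sum_congr rfl fun k _ => ?_
    push_cast
    ring
  rw [h1]
  refine (norm_sq_sum_mul_le _ _).trans_eq ?_
  rw [dotProduct_pow_eq_sum h h]
  simp only [sq]

theorem kernelForm_dotProduct_pow_nonneg {ι : Type*} [Fintype ι] {d : ℕ} (a : ι → Fin d → ℝ)
    (v : ι → ℂ) (j : ℕ) : 0 ≤ kernelForm (fun k l => (a k ⬝ᵥ a l) ^ j) v := by
  rw [kernelForm_dotProduct_pow]
  positivity

theorem hasSum_exp_sub_one (x : ℝ) :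
    HasSum (fun j : ℕ => x ^ (j + 1) / ((j + 1).factorial : ℝ)) (Real.exp x - 1) := by
  have h := NormedSpace.expSeries_div_hasSum_exp (𝔸 := ℝ) x
  rw [← Real.exp_eq_exp_ℝ] at h
  simpa using (hasSum_nat_add_iff' (f := fun j : ℕ => x ^ j / (j.factorial : ℝ)) 1).2 h

theorem hasSum_cexp_sub_one (x : ℂ) :
    HasSum (fun j : ℕ => x ^ (j + 1) / ((j + 1).factorial : ℂ)) (Complex.exp x - 1) := by
  have h := NormedSpace.expSeries_div_hasSum_exp (𝔸 := ℂ) x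
  rw [← Complex.exp_eq_exp_ℂ] at h
  simpa using (hasSum_nat_add_iff' (f := fun j : ℕ => x ^ j / (j.factorial : ℂ)) 1).2 h

/-- Cauchy–Schwarz over the Taylor degrees j ≥ 1, after splitting ρ^{2j}/(j!)² as (ρκ)^j/j! times
(ρ/κ)^j/j!. With this weight the two factors balance: where |a_k| = κ, the diagonal of the kernel is
again e^{ρκ} - 1. -/
theorem norm_sq_sum_cexp_sub_one_le {ι : Type*} [Fintype ι] {d : ℕ} (a : ι → Fin d → ℝ)
    (v : ι → ℂ) (h : Fin d → ℝ) {ρ κ : ℝ} (hρ : 0 < ρ) (hκ : 0 < κ) (hh : h ⬝ᵥ h ≤ ρ ^ 2) :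
    ‖∑ k, v k * (Complex.exp (((a k ⬝ᵥ h : ℝ) : ℂ) * Complex.I) - 1)‖ ^ 2 ≤
      (Real.exp (ρ * κ) - 1) *
        kernelForm (fun k l => Real.exp (ρ / κ * (a k ⬝ᵥ a l)) - 1) v := by
  have hL : Filter.Tendsto (fun J : ℕ => ‖∑ k, v k * ∑ j ∈ Finset.range J,
      (((a k ⬝ᵥ h : ℝ) : ℂ) * Complex.I) ^ (j + 1) / ((j + 1).factorial : ℂ)‖ ^ 2) Filter.atTop
      (nhds (‖∑ k, v k * (Complex.exp (((a k ⬝ᵥ h : ℝ) : ℂ) * Complex.I) - 1)‖ ^ 2)) := by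
    refine ((tendsto_finsetSum _ fun k _ => ?_).norm).pow 2
    exact (hasSum_cexp_sub_one _).tendsto_sum_nat.const_mul _
  have hR : Filter.Tendsto (fun J : ℕ =>
      (∑ j ∈ Finset.range J, (ρ * κ) ^ (j + 1) / ((j + 1).factorial : ℝ)) *
        kernelForm (fun k l => ∑ j ∈ Finset.range J,
          (ρ / κ * (a k ⬝ᵥ a l)) ^ (j + 1) / ((j + 1).factorial : ℝ)) v) Filter.atTop
      (nhds ((Real.exp (ρ * κ) - 1) *
        kernelForm (fun k l => Real.exp (ρ / κ * (a k ⬝ᵥ a l)) - 1) v)) := by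
    refine (hasSum_exp_sub_one _).tendsto_sum_nat.mul ?_
    refine tendsto_finsetSum _ fun k _ => tendsto_finsetSum _ fun l _ => ?_
    exact (hasSum_exp_sub_one _).tendsto_sum_nat.const_mul _
  -- It is enough to treat partial sums, where all sums are finite.
  refine le_of_tendsto_of_tendsto' hL hR fun J => ?_
  have h1 : ∑ k, v k * ∑ j ∈ Finset.range J,
      (((a k ⬝ᵥ h : ℝ) : ℂ) * Complex.I) ^ (j + 1) / ((j + 1).factorial : ℂ) =
      ∑ j ∈ Finset.range J, Complex.I ^ (j + 1) / ((j + 1).factorial : ℂ) *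
        ∑ k, v k * (((a k ⬝ᵥ h) ^ (j + 1) : ℝ) : ℂ) := by
    simp only [Finset.mul_sum]
    rw [Finset.sum_comm]
    refine Finset.sum_congr rfl fun j _ => Finset.sum_congr rfl fun k _ => ?_
    push_cast
    ring
  have h2 : kernelForm (fun k l => ∑ j ∈ Finset.range J,
      (ρ / κ * (a k ⬝ᵥ a l)) ^ (j + 1) / ((j + 1).factorial : ℝ)) v =
      ∑ j ∈ Finset.range J, (ρ / κ) ^ (j + 1) / ((j + 1).factorial : ℝ) *
        kernelForm (fun k l => (a k ⬝ᵥ a l) ^ (j + 1)) v := by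
    rw [kernelForm_sum]
    refine Finset.sum_congr rfl fun j _ => ?_
    rw [← kernelForm_const_mul]
    congr 1
    funext k l
    ring
  rw [h1, h2]
  have h3 : ‖∑ j ∈ Finset.range J, Complex.I ^ (j + 1) / ((j + 1).factorial : ℂ) *
        ∑ k, v k * (((a k ⬝ᵥ h) ^ (j + 1) : ℝ) : ℂ)‖ ≤
      ∑ j ∈ Finset.range J, ‖∑ k, v k * (((a k ⬝ᵥ h) ^ (j + 1) : ℝ) : ℂ)‖ /
        ((j + 1).factorial : ℝ) := by
    refine (norm_sum_le _ _).trans_eq (Finset.sum_congr rfl fun j _ => ?_)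
    rw [norm_mul, norm_div, norm_pow, Complex.norm_I, one_pow, Complex.norm_natCast]
    ring
  refine (pow_le_pow_left₀ (norm_nonneg _) h3 2).trans ?_
  refine Finset.sum_sq_le_sum_mul_sum_of_sq_le_mul _ (fun j _ => by positivity)
    (fun j _ => mul_nonneg (by positivity) (kernelForm_dotProduct_pow_nonneg a v _)) fun j _ => ?_
  have h4 := norm_sq_sum_dotProduct_pow_le a v h (j + 1)
  have h5 : (h ⬝ᵥ h) ^ (j + 1) ≤ (ρ ^ 2) ^ (j + 1) :=
    pow_le_pow_left₀ (Finset.sum_nonneg fun i _ => mul_self_nonneg _) hh _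
  have h6 := h4.trans (mul_le_mul_of_nonneg_right h5 (kernelForm_dotProduct_pow_nonneg a v _))
  rw [div_pow, div_le_iff₀ (by positivity)]
  refine h6.trans_eq ?_
  rw [div_pow, mul_pow]
  field_simp
  ring

/-! ### Boxes, characters and orthogonality -/

/-- The box `∏ᵢ [lo i, hi i]` in Euclidean space. -/
def euclideanBox {d : ℕ} (lo hi : Fin d → ℝ) : Set (EuclideanSpace ℝ (Fin d)) :=
  {y | ∀ i, y i ∈ Set.Icc (lo i) (hi i)}

theorem unitCube_eq_euclideanBox (d : ℕ) :
    unitCube d = euclideanBox (fun _ => 0) (fun _ => 1) := rfl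

theorem euclideanBox_eq_preimage {d : ℕ} (lo hi : Fin d → ℝ) :
    euclideanBox lo hi =
      (WithLp.ofLp : EuclideanSpace ℝ (Fin d) → Fin d → ℝ) ⁻¹'
        (Set.univ.pi fun i => Set.Icc (lo i) (hi i)) := by
  ext y
  simp only [euclideanBox, Set.mem_ofPred_eq, Set.mem_preimage, Set.mem_univ_pi]

theorem isClosed_euclideanBox {d : ℕ} (lo hi : Fin d → ℝ) : IsClosed (euclideanBox lo hi) := by
  rw [euclideanBox_eq_preimage]
  exact (isClosed_set_pi fun i _ => isClosed_Icc).preimage (PiLp.continuous_ofLp 2 _)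

theorem volume_euclideanBox {d : ℕ} (lo hi : Fin d → ℝ) :
    volume (euclideanBox lo hi) = ∏ i, ENNReal.ofReal (hi i - lo i) := by
  rw [euclideanBox_eq_preimage, (PiLp.volume_preserving_ofLp (Fin d)).measure_preimage
    (MeasurableSet.univ_pi fun i => measurableSet_Icc).nullMeasurableSet, volume_pi_pi]
  simp

theorem volume_unitCube (d : ℕ) : volume (unitCube d) = 1 := by
  simp [unitCube_eq_euclideanBox, volume_euclideanBox]

theorem isCompact_unitCube (d : ℕ) : IsCompact (unitCube d) := by
  have h : unitCube d = (EuclideanSpace.equiv (Fin d) ℝ).symm ''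
      (Set.univ.pi fun _ => Set.Icc (0 : ℝ) 1) := by
    rw [unitCube_eq_euclideanBox, euclideanBox_eq_preimage]
    exact ((EuclideanSpace.equiv (Fin d) ℝ).toEquiv.image_symm_eq_preimage _).symm
  rw [h]
  exact (isCompact_univ_pi fun _ => isCompact_Icc).image
    (EuclideanSpace.equiv (Fin d) ℝ).symm.continuous

theorem isClosed_unitCube (d : ℕ) : IsClosed (unitCube d) := (isCompact_unitCube d).isClosed

/-- The character `y ↦ exp (2πi k·y)`. -/
def fourierCharacter {d : ℕ} (k : Fin d → ℤ) (y : EuclideanSpace ℝ (Fin d)) : ℂ :=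
  Complex.exp (2 * Real.pi * Complex.I * ((∑ i, (k i : ℝ) * y i : ℝ) : ℂ))

theorem continuous_fourierCharacter {d : ℕ} (k : Fin d → ℤ) :
    Continuous (fourierCharacter k) := by
  unfold fourierCharacter
  fun_prop

theorem fourierCharacter_mul_star {d : ℕ} (k l : Fin d → ℤ) (y : EuclideanSpace ℝ (Fin d)) :
    fourierCharacter k y * star (fourierCharacter l y) = fourierCharacter (k - l) y := by
  rw [fourierCharacter, fourierCharacter, fourierCharacter, Complex.star_def, ← Complex.exp_conj,
    ← Complex.exp_add]
  congr 1
  simp only [map_mul, Complex.conj_ofReal, Complex.conj_I, map_ofNat, Pi.sub_apply, Int.cast_sub,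
    sub_mul, Finset.sum_sub_distrib, Complex.ofReal_sub]
  ring

theorem integral_Icc_exp_int (n : ℤ) :
    ∫ t in Set.Icc (0 : ℝ) 1, Complex.exp (2 * Real.pi * Complex.I * (n * t : ℝ)) =
      if n = 0 then 1 else 0 := by
  rw [integral_Icc_eq_integral_Ioc, ← intervalIntegral.integral_of_le zero_le_one]
  split_ifs with h
  · simp [h]
  · have hc : (2 * Real.pi * Complex.I * n : ℂ) ≠ 0 := by
      simp [h, Real.pi_ne_zero, Complex.I_ne_zero]
    have := integral_exp_mul_complex (a := 0) (b := 1) hc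
    simp only [Complex.ofReal_mul, Complex.ofReal_intCast, ← mul_assoc] at this ⊢
    rw [this]
    have h1 : Complex.exp (2 * Real.pi * Complex.I * n) = 1 := by
      rw [Complex.exp_eq_one_iff]
      exact ⟨n, by ring⟩
    simp [h1]

theorem integral_unitCube_fourierCharacter {d : ℕ} (k : Fin d → ℤ) :
    ∫ y in unitCube d, fourierCharacter k y = if k = 0 then 1 else 0 := by
  have h1 : ∀ y : EuclideanSpace ℝ (Fin d), fourierCharacter k y =
      (fun z : Fin d → ℝ => ∏ i, Complex.exp (2 * Real.pi * Complex.I * (k i * z i : ℝ)))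
        (WithLp.ofLp y) := by
    intro y
    simp only [fourierCharacter, ← Complex.exp_sum, Complex.ofReal_sum, Finset.mul_sum]
  simp_rw [h1]
  rw [unitCube_eq_euclideanBox, euclideanBox_eq_preimage,
    (PiLp.volume_preserving_ofLp (Fin d)).setIntegral_preimage_emb
      (MeasurableEquiv.toLp 2 (Fin d → ℝ)).symm.measurableEmbedding
      (fun z : Fin d → ℝ => ∏ i, Complex.exp (2 * Real.pi * Complex.I * (k i * z i : ℝ))),
    volume_pi,
    Measure.restrict_pi_pi,
    integral_fintype_prod_eq_prod (𝕜 := ℂ)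
      (fun i (t : ℝ) => Complex.exp (2 * Real.pi * Complex.I * (k i * t : ℝ)))]
  simp_rw [integral_Icc_exp_int]
  rw [Finset.prod_ite_zero]
  simp [funext_iff]

theorem integrableOn_unitCube {d : ℕ} {E : Type*} [NormedAddCommGroup E]
    {f : EuclideanSpace ℝ (Fin d) → E} (hf : Continuous f) : IntegrableOn f (unitCube d) :=
  hf.continuousOn.integrableOn_compact (isCompact_unitCube d)

theorem continuous_kernelForm {X ι : Type*} [TopologicalSpace X] [Fintype ι] (φ : ι → ι → ℝ)
    {v : X → ι → ℂ} (hv : ∀ k, Continuous fun y => v y k) :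
    Continuous fun y => kernelForm φ (v y) := by
  unfold kernelForm
  refine continuous_finsetSum _ fun k _ => continuous_finsetSum _ fun l _ => ?_
  exact (Complex.continuous_re.comp ((hv k).mul (continuous_star.comp (hv l)))).mul
    continuous_const

/-- The entry (k, l) carries the character of k - l, whose integral vanishes off the diagonal. -/
theorem integral_unitCube_kernelForm {d : ℕ} (Γ : Finset (Fin d → ℤ)) (φ : Γ → Γ → ℝ)
    (c : Γ → ℂ) :
    ∫ y in unitCube d, kernelForm φ (fun k => c k * fourierCharacter k.1 y) =
      ∑ k, ‖c k‖ ^ 2 * φ k k := by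
  have hterm : ∀ (k l : Γ), (fun y : EuclideanSpace ℝ (Fin d) =>
      (c k * fourierCharacter k.1 y * star (c l * fourierCharacter l.1 y)).re * φ k l) =
      fun y => RCLike.re (c k * star (c l) * (φ k l : ℂ) * fourierCharacter (k.1 - l.1) y) := by
    intro k l
    funext y
    rw [← fourierCharacter_mul_star, RCLike.re_eq_complex_re, ← Complex.re_mul_ofReal, star_mul]
    congr 1
    ring
  have hint : ∀ (k l : Γ), IntegrableOn (fun y : EuclideanSpace ℝ (Fin d) =>
      c k * star (c l) * (φ k l : ℂ) * fourierCharacter (k.1 - l.1) y) (unitCube d) := fun k l =>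
    integrableOn_unitCube (continuous_const.mul (continuous_fourierCharacter _))
  have hint' : ∀ (k l : Γ), IntegrableOn (fun y : EuclideanSpace ℝ (Fin d) =>
      (c k * fourierCharacter k.1 y * star (c l * fourierCharacter l.1 y)).re * φ k l)
        (unitCube d) := by
    intro k l
    rw [hterm]
    exact (hint k l).re
  unfold kernelForm
  rw [integral_finsetSum _ fun k _ => integrable_finsetSum _ fun l _ => hint' k l]
  refine Finset.sum_congr rfl fun k _ => ?_
  rw [integral_finsetSum _ fun l _ => hint' k l]
  rw [Finset.sum_eq_single k]
  · rw [hterm, integral_re (hint k k), integral_const_mul, integral_unitCube_fourierCharacter]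
    rw [sub_self, if_pos rfl, mul_one, Complex.star_def, Complex.mul_conj', RCLike.re_eq_complex_re]
    norm_cast
  · intro l _ hl
    rw [hterm, integral_re (hint k l), integral_const_mul, integral_unitCube_fourierCharacter]
    rw [if_neg (fun h => hl (Subtype.ext (sub_eq_zero.1 h).symm))]
    simp
  · simp

/-! ### Voronoi regions as a quadrature rule -/

theorem voronoiRegion_subset_unitCube {d n : ℕ} (x : Fin n → EuclideanSpace ℝ (Fin d))
    (t : Fin n) : voronoiRegion x t ⊆ unitCube d := fun _ hy => hy.1

theorem isClosed_voronoiRegion {d n : ℕ} (x : Fin n → EuclideanSpace ℝ (Fin d)) (t : Fin n) :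
    IsClosed (voronoiRegion x t) := by
  have h : voronoiRegion x t = unitCube d ∩ ⋂ s, ⋂ (_ : s ≠ t), {y | ‖y - x t‖ ≤ ‖y - x s‖} := by
    ext y
    simp [voronoiRegion]
  rw [h]
  refine (isClosed_unitCube d).inter (isClosed_iInter fun s => isClosed_iInter fun _ => ?_)
  exact isClosed_le (by fun_prop) (by fun_prop)

theorem iUnion_voronoiRegion {d n : ℕ} (hn : 1 ≤ n) (x : Fin n → EuclideanSpace ℝ (Fin d)) :
    ⋃ t, voronoiRegion x t = unitCube d := by
  refine Set.Subset.antisymm (Set.iUnion_subset (voronoiRegion_subset_unitCube x)) fun y hy => ?_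
  have : Nonempty (Fin n) := ⟨⟨0, hn⟩⟩
  obtain ⟨t, ht⟩ := Finite.exists_min fun t => ‖y - x t‖
  exact Set.mem_iUnion.2 ⟨t, hy, fun s _ => ht s⟩

/-- Two regions meet inside the perpendicular bisector of their centres, a null hyperplane because
the centres differ. -/
theorem aedisjoint_voronoiRegion {d n : ℕ} {x : Fin n → EuclideanSpace ℝ (Fin d)}
    (hx : Function.Injective x) :
    Pairwise (Function.onFun (AEDisjoint volume) (voronoiRegion x)) := by
  intro s t hst
  refine measure_mono_null (t := (AffineSubspace.perpBisector (x s) (x t) : Set _)) ?_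
    (Measure.addHaar_affineSubspace _ _ fun h => hst (hx (AffineSubspace.perpBisector_eq_top.1 h)))
  rintro y ⟨h1, h2⟩
  refine AffineSubspace.mem_perpBisector_iff_dist_eq.2 ?_
  rw [dist_eq_norm, dist_eq_norm]
  exact le_antisymm (h1.2 t hst.symm) (h2.2 s hst)

theorem integral_unitCube_eq_sum_voronoiRegion {d n : ℕ} (hn : 1 ≤ n)
    {x : Fin n → EuclideanSpace ℝ (Fin d)} (hx : Function.Injective x)
    {F : EuclideanSpace ℝ (Fin d) → ℝ} (hF : Continuous F) :
    ∫ y in unitCube d, F y = ∑ t, ∫ y in voronoiRegion x t, F y := by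
  have h := hasSum_integral_iUnion_ae (μ := volume)
    (fun t => (isClosed_voronoiRegion x t).measurableSet.nullMeasurableSet)
    (aedisjoint_voronoiRegion hx)
    ((integrableOn_unitCube hF).mono_set (iUnion_voronoiRegion hn x).subset)
  rw [iUnion_voronoiRegion hn] at h
  rw [← h.tsum_eq, tsum_fintype]

theorem volume_voronoiRegion_ne_top {d n : ℕ} (x : Fin n → EuclideanSpace ℝ (Fin d))
    (t : Fin n) : volume (voronoiRegion x t) ≠ ⊤ :=
  ne_top_of_le_ne_top (by rw [volume_unitCube]; exact ENNReal.one_ne_top)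
    (measure_mono (voronoiRegion_subset_unitCube x t))

theorem sum_voronoiWeight_mul_le {d n : ℕ} (hn : 1 ≤ n)
    {x : Fin n → EuclideanSpace ℝ (Fin d)} (hx : Function.Injective x)
    {F : EuclideanSpace ℝ (Fin d) → ℝ} (hF : Continuous F) {q : Fin n → ℝ}
    (h : ∀ t, ∀ y ∈ voronoiRegion x t, q t ≤ F y) :
    ∑ t, voronoiWeight x t * q t ≤ ∫ y in unitCube d, F y := by
  rw [integral_unitCube_eq_sum_voronoiRegion hn hx hF]
  refine Finset.sum_le_sum fun t _ => ?_
  rw [voronoiWeight, ← smul_eq_mul, ← setIntegral_const]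
  exact setIntegral_mono_on (integrableOn_const (volume_voronoiRegion_ne_top x t))
    ((integrableOn_unitCube hF).mono_set (voronoiRegion_subset_unitCube x t))
    (isClosed_voronoiRegion x t).measurableSet (h t)

theorem le_sum_voronoiWeight_mul {d n : ℕ} (hn : 1 ≤ n)
    {x : Fin n → EuclideanSpace ℝ (Fin d)} (hx : Function.Injective x)
    {F : EuclideanSpace ℝ (Fin d) → ℝ} (hF : Continuous F) {q : Fin n → ℝ}
    (h : ∀ t, ∀ y ∈ voronoiRegion x t, F y ≤ q t) :
    ∫ y in unitCube d, F y ≤ ∑ t, voronoiWeight x t * q t := by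
  have := sum_voronoiWeight_mul_le hn hx hF.neg (q := fun t => -q t)
    fun t y hy => neg_le_neg (h t y hy)
  simp only [Pi.neg_apply, mul_neg, Finset.sum_neg_distrib, integral_neg] at this
  exact neg_le_neg_iff.1 this

/-! ### From the quadratic form to the condition number -/

theorem re_dotProduct_weightedMatrix_mulVec {d n : ℕ} (Γ : Finset (Fin d → ℤ))
    (x : Fin n → EuclideanSpace ℝ (Fin d)) (c : Γ → ℂ) :
    (star c ⬝ᵥ (weightedMatrix Γ x *ᵥ c)).re =
      ∑ t, voronoiWeight x t * ‖∑ k : Γ, c k * fourierCharacter k.1 (x t)‖ ^ 2 := by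
  have h : ∀ t, (fourierMatrix Γ x *ᵥ c) t = ∑ k : Γ, c k * fourierCharacter k.1 (x t) :=
    fun t => Finset.sum_congr rfl fun k _ => mul_comm _ _
  rw [weightedMatrix, ← Matrix.mulVec_mulVec, ← Matrix.mulVec_mulVec, Matrix.dotProduct_mulVec,
    ← Matrix.star_mulVec, dotProduct, Complex.re_sum]
  refine Finset.sum_congr rfl fun t _ => ?_
  rw [Matrix.mulVec_diagonal, Pi.star_apply, h, mul_left_comm, Complex.star_def,
    Complex.conj_mul']
  norm_cast

/-- An eigenvalue is the value of the form at its unit eigenvector. -/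
theorem eigenvalues_mem_Icc {ι : Type*} [Fintype ι] [DecidableEq ι] {A : Matrix ι ι ℂ}
    (hA : A.IsHermitian) {a b : ℝ}
    (h : ∀ c : ι → ℂ, (star c ⬝ᵥ (A *ᵥ c)).re ∈
      Set.Icc (a * ∑ k, ‖c k‖ ^ 2) (b * ∑ k, ‖c k‖ ^ 2)) (i : ι) :
    hA.eigenvalues i ∈ Set.Icc a b := by
  have h1 : ∑ k, ‖hA.eigenvectorBasis i k‖ ^ 2 = 1 := by
    rw [← EuclideanSpace.norm_sq_eq, hA.eigenvectorBasis.orthonormal.1 i, one_pow]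
  have h2 := h (hA.eigenvectorBasis i)
  rw [h1, mul_one, mul_one] at h2
  rw [hA.eigenvalues_eq]
  exact h2

theorem lambdaMin_pos_and_conditionNumber_le {ι : Type*} [Fintype ι] [DecidableEq ι] [Nonempty ι]
    {A : Matrix ι ι ℂ} (hA : A.IsHermitian) {a b : ℝ} (ha : 0 < a)
    (h : ∀ c : ι → ℂ, (star c ⬝ᵥ (A *ᵥ c)).re ∈
      Set.Icc (a * ∑ k, ‖c k‖ ^ 2) (b * ∑ k, ‖c k‖ ^ 2)) :
    0 < lambdaMin hA ∧ conditionNumber hA ≤ b / a := by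
  have hi := eigenvalues_mem_Icc hA h
  have h1 : a ≤ lambdaMin hA := le_ciInf fun i => (hi i).1
  have h2 : lambdaMax hA ≤ b := ciSup_le fun i => (hi i).2
  obtain ⟨i⟩ := ‹Nonempty ι›
  have hb : 0 ≤ b := ha.le.trans ((hi i).1.trans (hi i).2)
  exact ⟨ha.trans_le h1, div_le_div₀ hb h2 ha h1⟩

/-- Weighted Cauchy–Schwarz: (b + e)² ≤ (1 + A)(b² + e²/A). -/
theorem sq_le_of_le_add {A b e p S : ℝ} (hA : 0 < A) (hp : 0 ≤ p) (he : e ^ 2 ≤ A * S)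
    (h : p ≤ b + e) : p ^ 2 ≤ (1 + A) * (b ^ 2 + S) := by
  have h1 : p ^ 2 ≤ (b + e) ^ 2 := pow_le_pow_left₀ hp h 2
  have h2 : A * (b + e) ^ 2 ≤ (1 + A) * (A * b ^ 2 + e ^ 2) := by
    linarith [sq_nonneg (A * b - e), (by ring : (1 + A) * (A * b ^ 2 + e ^ 2) - A * (b + e) ^ 2 =
      (A * b - e) ^ 2)]
  have h3 : (1 + A) * (A * b ^ 2 + e ^ 2) ≤ (1 + A) * (A * b ^ 2 + A * S) := by gcongr
  refine h1.trans (le_of_mul_le_mul_left ?_ hA)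
  linarith

/-- Weighted Cauchy–Schwarz: (p + e)² ≤ p²/(1 - A) + e²/A. -/
theorem le_sq_of_le_add {A b e p S : ℝ} (hA : 0 < A) (hA1 : A < 1) (hb : 0 ≤ b)
    (he : e ^ 2 ≤ A * S) (h : b ≤ p + e) : (1 - A) * (b ^ 2 - S) ≤ p ^ 2 := by
  have h1 : b ^ 2 ≤ (p + e) ^ 2 := pow_le_pow_left₀ hb h 2
  have h2 : A * (1 - A) * (p + e) ^ 2 ≤ A * p ^ 2 + (1 - A) * e ^ 2 := by
    linarith [sq_nonneg (A * p - (1 - A) * e), (by ring : A * p ^ 2 + (1 - A) * e ^ 2 -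
      A * (1 - A) * (p + e) ^ 2 = (A * p - (1 - A) * e) ^ 2)]
  have h3 : A * (1 - A) * b ^ 2 ≤ A * (1 - A) * (p + e) ^ 2 :=
    mul_le_mul_of_nonneg_left h1 (mul_nonneg hA.le (by linarith))
  have h4 : (1 - A) * e ^ 2 ≤ (1 - A) * (A * S) :=
    mul_le_mul_of_nonneg_left he (by linarith)
  refine le_of_mul_le_mul_left ?_ hA
  linarith

theorem norm_sq_trigPolynomial_sub_le {d : ℕ} (Γ : Finset (Fin d → ℤ)) (c : Γ → ℂ)
    {r κ : ℝ} (hr : 0 < r) (hκ : 0 < κ) {x y : EuclideanSpace ℝ (Fin d)} (hxy : ‖y - x‖ ≤ r) :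
    ‖∑ k : Γ, c k * fourierCharacter k.1 x - ∑ k : Γ, c k * fourierCharacter k.1 y‖ ^ 2 ≤
      (Real.exp (2 * Real.pi * r * κ) - 1) *
        kernelForm (fun k l : Γ => Real.exp (2 * Real.pi * r / κ *
          ((fun i => (k.1 i : ℝ)) ⬝ᵥ fun i => (l.1 i : ℝ))) - 1)
          (fun k => c k * fourierCharacter k.1 y) := by
  have h := norm_sq_sum_cexp_sub_one_le (fun (k : Γ) i => (k.1 i : ℝ))
    (fun k => c k * fourierCharacter k.1 y) (fun i => 2 * Real.pi * (x i - y i))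
    (ρ := 2 * Real.pi * r) (by positivity) hκ (by
      have h1 : ‖y - x‖ ^ 2 ≤ r ^ 2 := pow_le_pow_left₀ (norm_nonneg _) hxy 2
      rw [EuclideanSpace.norm_sq_eq] at h1
      calc _ = (2 * Real.pi) ^ 2 * ∑ i, ‖(y - x) i‖ ^ 2 := by
            rw [dotProduct, Finset.mul_sum]
            refine Finset.sum_congr rfl fun i _ => ?_
            rw [Real.norm_eq_abs, sq_abs, PiLp.sub_apply]
            ring
        _ ≤ (2 * Real.pi) ^ 2 * r ^ 2 := by gcongr
        _ = _ := by ring)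
  refine le_of_eq_of_le ?_ h
  rw [← Finset.sum_sub_distrib]
  congr 2
  refine Finset.sum_congr rfl fun k _ => ?_
  rw [mul_sub, mul_one, mul_assoc, fourierCharacter, fourierCharacter, ← Complex.exp_add]
  congr 3
  have h2 : ((fun i => (k.1 i : ℝ)) ⬝ᵥ fun i => 2 * Real.pi * (x i - y i)) =
      2 * Real.pi * (∑ i, (k.1 i : ℝ) * x i - ∑ i, (k.1 i : ℝ) * y i) := by
    rw [dotProduct, ← Finset.sum_sub_distrib, Finset.mul_sum]
    exact Finset.sum_congr rfl fun i _ => by ring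
  rw [h2, Complex.ofReal_mul, Complex.ofReal_sub, Complex.ofReal_mul, Complex.ofReal_ofNat]
  ring

theorem re_dotProduct_weightedMatrix_mulVec_mem_Icc {d n : ℕ} (hn : 1 ≤ n)
    (Γ : Finset (Fin d → ℤ)) {x : Fin n → EuclideanSpace ℝ (Fin d)} (hx : Function.Injective x)
    {r κ A : ℝ} (hr : 0 < r) (hκ : 0 < κ) (hΓ : ∀ k ∈ Γ, ∑ i, (k i : ℝ) ^ 2 ≤ κ ^ 2)
    (hcover : ∀ y ∈ unitCube d, ∃ s, ‖y - x s‖ ≤ r)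
    (hA : Real.exp (2 * Real.pi * r * κ) - 1 = A) (hA1 : A < 1) (c : Γ → ℂ) :
    (star c ⬝ᵥ (weightedMatrix Γ x *ᵥ c)).re ∈
      Set.Icc ((1 - A) ^ 2 * ∑ k, ‖c k‖ ^ 2) ((1 + A) ^ 2 * ∑ k, ‖c k‖ ^ 2) := by
  have hA0 : 0 < A := by
    rw [← hA, sub_pos, Real.one_lt_exp_iff]
    positivity
  have hclose : ∀ t, ∀ y ∈ voronoiRegion x t, ‖y - x t‖ ≤ r := by
    intro t y hy
    obtain ⟨s, hs⟩ := hcover y hy.1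
    by_cases hst : s = t
    · rwa [← hst]
    · exact (hy.2 s hst).trans hs
  set φ : Γ → Γ → ℝ := fun k l => Real.exp (2 * Real.pi * r / κ *
    ((fun i => (k.1 i : ℝ)) ⬝ᵥ fun i => (l.1 i : ℝ))) - 1 with hφ
  let v : EuclideanSpace ℝ (Fin d) → Γ → ℂ := fun y k => c k * fourierCharacter k.1 y
  have hv : ∀ k, Continuous fun y => v y k := fun k =>
    continuous_const.mul (continuous_fourierCharacter _)
  have hnorm : ∀ y, ‖∑ k : Γ, c k * fourierCharacter k.1 y‖ ^ 2 =
      kernelForm (fun _ _ => 1) (v y) := by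
    intro y
    simpa [v] using norm_sq_sum_eq_kernelForm (fun _ : Γ => (1 : ℝ)) (v y)
  have hdiff : ∀ t, ∀ y ∈ voronoiRegion x t,
      ‖∑ k : Γ, c k * fourierCharacter k.1 (x t) - ∑ k : Γ, c k * fourierCharacter k.1 y‖ ^ 2 ≤
        A * kernelForm φ (v y) := by
    intro t y hy
    rw [← hA]
    exact norm_sq_trigPolynomial_sub_le Γ c hr hκ (hclose t y hy)
  have hc1 := continuous_kernelForm (fun _ _ => 1) hv
  have hc2 := continuous_kernelForm φ hv
  have hi1 : ∫ y in unitCube d, kernelForm (fun _ _ => 1) (v y) = ∑ k, ‖c k‖ ^ 2 := by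
    simpa using integral_unitCube_kernelForm Γ (fun _ _ => 1) c
  -- Only the diagonal e^{(2πr/κ)|k|²} - 1 remains, and |k| ≤ κ.
  have hi2 : ∫ y in unitCube d, kernelForm φ (v y) ≤ A * ∑ k, ‖c k‖ ^ 2 := by
    refine (integral_unitCube_kernelForm Γ φ c).trans_le ?_
    rw [Finset.mul_sum]
    refine Finset.sum_le_sum fun k _ => ?_
    rw [mul_comm]
    refine mul_le_mul_of_nonneg_right ?_ (sq_nonneg _)
    rw [← hA, hφ]
    refine sub_le_sub_right (Real.exp_le_exp.2 ?_) _
    have h1 : ((fun i => (k.1 i : ℝ)) ⬝ᵥ fun i => (k.1 i : ℝ)) ≤ κ ^ 2 := by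
      simpa only [dotProduct, ← sq] using hΓ k.1 k.2
    calc _ ≤ 2 * Real.pi * r / κ * κ ^ 2 := by gcongr
      _ = _ := by field_simp
  have hI1 := integrableOn_unitCube hc1
  have hI2 := integrableOn_unitCube hc2
  rw [re_dotProduct_weightedMatrix_mulVec]
  constructor
  · refine le_trans ?_ (le_sum_voronoiWeight_mul hn hx
      (F := fun y => (1 - A) * (kernelForm (fun _ _ => 1) (v y) - kernelForm φ (v y)))
      (continuous_const.mul (hc1.sub hc2)) fun t y hy => ?_)
    · rw [integral_const_mul, integral_sub hI1 hI2, hi1, sq, mul_assoc]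
      refine mul_le_mul_of_nonneg_left ?_ (by linarith)
      linarith
    · rw [← hnorm]
      refine le_sq_of_le_add hA0 hA1 (norm_nonneg _) (hdiff t y hy) ?_
      rw [norm_sub_rev, add_comm]
      exact norm_le_norm_sub_add _ _
  · refine le_trans (sum_voronoiWeight_mul_le hn hx
      (F := fun y => (1 + A) * (kernelForm (fun _ _ => 1) (v y) + kernelForm φ (v y)))
      (continuous_const.mul (hc1.add hc2)) fun t y hy => ?_) ?_
    · rw [← hnorm]
      refine sq_le_of_le_add hA0 (norm_nonneg _) (hdiff t y hy) ?_
      rw [add_comm]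
      exact norm_le_norm_sub_add _ _
    · rw [integral_const_mul, integral_add hI1 hI2, hi1, sq, mul_assoc]
      refine mul_le_mul_of_nonneg_left ?_ (by linarith)
      linarith

theorem sum_sq_le_of_mem_cubeFrequencies {d m : ℕ} {k : Fin d → ℤ}
    (hk : k ∈ cubeFrequencies d m) : ∑ i, (k i : ℝ) ^ 2 ≤ (m * √d) ^ 2 := by
  rw [mul_pow, Real.sq_sqrt (Nat.cast_nonneg _)]
  have h : ∀ i ∈ Finset.univ, (k i : ℝ) ^ 2 ≤ (m : ℝ) ^ 2 := by
    intro i _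
    have := Finset.mem_Icc.1 (Fintype.mem_piFinset.1 hk i)
    refine sq_le_sq' ?_ ?_
    · exact_mod_cast this.1
    · exact_mod_cast this.2
  refine (Finset.sum_le_sum h).trans_eq ?_
  rw [Finset.sum_const, Finset.card_univ, Fintype.card_fin, nsmul_eq_mul, mul_comm]

theorem conditionNumber_weightedMatrix_le {d m n : ℕ} (hn : 1 ≤ n)
    {x : Fin n → EuclideanSpace ℝ (Fin d)} (hx : Function.Injective x)
    {r κ γ : ℝ} (hγ : γ < 1) (hr : 0 < r) (hκ : 0 < κ) (hm : m * √d ≤ κ)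
    (hcover : ∀ y ∈ unitCube d, ∃ s, ‖y - x s‖ ≤ r)
    (hrκ : 2 * Real.pi * r * κ = γ * Real.log 2) :
    0 < lambdaMin (weightedMatrix_isHermitian (cubeFrequencies d m) x) ∧
      conditionNumber (weightedMatrix_isHermitian (cubeFrequencies d m) x) ≤
        (1 - (2 : ℝ) ^ (γ - 1)) ^ (-2 : ℤ) := by
  have hA : Real.exp (2 * Real.pi * r * κ) - 1 = 2 ^ γ - 1 := by
    rw [hrκ, Real.rpow_def_of_pos two_pos, mul_comm]
  have h2 : (2 : ℝ) ^ γ < 2 := by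
    simpa using Real.rpow_lt_rpow_of_exponent_lt one_lt_two hγ
  have h3 : (2 : ℝ) ^ (γ - 1) = 2 ^ γ / 2 := by rw [Real.rpow_sub two_pos, Real.rpow_one]
  have h0 : (0 : ℝ) < 2 ^ γ := Real.rpow_pos_of_pos two_pos _
  -- The frequency 0 makes the index set nonempty, so the extremal eigenvalues are genuine.
  have : Nonempty (cubeFrequencies d m) :=
    ⟨⟨0, Fintype.mem_piFinset.2 fun _ => Finset.mem_Icc.2 (by simp)⟩⟩
  have h4 := lambdaMin_pos_and_conditionNumber_le
    (weightedMatrix_isHermitian (cubeFrequencies d m) x)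
    (by nlinarith : (0 : ℝ) < (1 - (2 ^ γ - 1)) ^ 2)
    (re_dotProduct_weightedMatrix_mulVec_mem_Icc hn (cubeFrequencies d m) hx hr hκ
      (fun k hk => (sum_sq_le_of_mem_cubeFrequencies hk).trans
        (pow_le_pow_left₀ (by positivity) hm 2)) hcover hA (by linarith))
  refine ⟨h4.1, h4.2.trans ?_⟩
  -- The target is 4/(1 - A)², while the form bounds give (1 + A)²/(1 - A)² with 1 + A = 2^γ < 2.
  have h5 : (1 - (2 : ℝ) ^ (γ - 1)) ^ (-2 : ℤ) = 2 ^ 2 / (1 - (2 ^ γ - 1)) ^ 2 := by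
    have h6 : 1 - ((2 : ℝ) ^ γ - 1) = 2 * (1 - 2 ^ γ / 2) := by ring
    rw [h6, mul_pow, h3, zpow_neg, zpow_ofNat, div_mul_cancel_left₀ (by norm_num)]
  rw [h5]
  exact div_le_div_of_nonneg_right (pow_le_pow_left₀ (by linarith) (by linarith) 2) (sq_nonneg _)

/-! ### Independent uniform points: collisions and missed boxes -/

theorem measurableSet_injective_and_ae_injective {Ω : Type*} [MeasurableSpace Ω] (P : Measure Ω)
    [IsProbabilityMeasure P] {d n : ℕ} (hd : 1 ≤ d) {x : Fin n → Ω → EuclideanSpace ℝ (Fin d)}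
    (hmeas : ∀ t, Measurable (x t)) (hindep : iIndepFun x P)
    (hunif : ∀ t, pdf.IsUniform (x t) (unitCube d) P volume) :
    MeasurableSet {ω | Function.Injective fun t => x t ω} ∧
      P {ω | Function.Injective fun t => x t ω}ᶜ = 0 := by
  -- In positive dimension Lebesgue measure has no atoms, which makes the diagonal null for the
  -- product law.
  have : Nonempty (Fin d) := ⟨⟨0, hd⟩⟩
  have heq : {ω | Function.Injective fun t => x t ω}ᶜ =
      ⋃ s, ⋃ t, ⋃ (_ : s ≠ t), {ω | x s ω = x t ω} := by
    ext ω
    simp [Function.Injective, and_comm]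
  constructor
  · rw [← MeasurableSet.compl_iff, heq]
    exact MeasurableSet.iUnion fun s => MeasurableSet.iUnion fun t => MeasurableSet.iUnion fun _ =>
      measurableSet_eq_fun (hmeas s) (hmeas t)
  · rw [heq]
    refine measure_iUnion_null fun s => measure_iUnion_null fun t => measure_iUnion_null fun hst => ?_
    have h1 := (indepFun_iff_map_prod_eq_prod_map_map (hmeas s).aemeasurable
      (hmeas t).aemeasurable).1 (hindep.indepFun hst)
    have h2 : {ω | x s ω = x t ω} = (fun ω => (x s ω, x t ω)) ⁻¹' Set.diagonal _ := rfl
    have h3 : P.map (x t) ≪ volume := (hunif t).absolutelyContinuous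
    have := Measure.isProbabilityMeasure_map (hmeas t).aemeasurable (μ := P)
    rw [h2, ← Measure.map_apply ((hmeas s).prodMk (hmeas t)) measurableSet_diagonal, h1,
      Measure.measure_prod_null measurableSet_diagonal]
    refine Filter.Eventually.of_forall fun a => ?_
    have h4 : Prod.mk a ⁻¹' Set.diagonal (EuclideanSpace ℝ (Fin d)) = {a} := by
      ext b
      simp [eq_comm]
    exact (congrArg _ h4).trans (h3 (measure_singleton a))

/-- By independence the probability is (1 - |B|)^n, and 1 - |B| ≤ e^{-|B|}. -/
theorem measure_iInter_preimage_compl_le {Ω : Type*} [MeasurableSpace Ω] (P : Measure Ω)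
    [IsProbabilityMeasure P] {d n : ℕ} {x : Fin n → Ω → EuclideanSpace ℝ (Fin d)}
    (hindep : iIndepFun x P) (hunif : ∀ t, pdf.IsUniform (x t) (unitCube d) P volume)
    {B : Set (EuclideanSpace ℝ (Fin d))} (hB : MeasurableSet B) (hBC : B ⊆ unitCube d) :
    P (⋂ t, x t ⁻¹' Bᶜ) ≤ ENNReal.ofReal (Real.exp (-(n * volume.real B))) := by
  have hBtop : volume B ≠ ⊤ :=
    ne_top_of_le_ne_top (by rw [volume_unitCube]; exact ENNReal.one_ne_top) (measure_mono hBC)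
  have h1 : ∀ t, P (x t ⁻¹' Bᶜ) ≤ ENNReal.ofReal (Real.exp (-volume.real B)) := by
    intro t
    rw [(hunif t).measure_preimage (by simp [volume_unitCube]) (by simp [volume_unitCube])
      hB.compl, volume_unitCube, div_one, ← Set.sdiff_eq,
      measure_sdiff hBC hB.nullMeasurableSet hBtop, volume_unitCube,
      ← ENNReal.ofReal_toReal hBtop, ← ENNReal.ofReal_one,
      ← ENNReal.ofReal_sub _ ENNReal.toReal_nonneg]
    refine ENNReal.ofReal_le_ofReal ?_
    have := Real.add_one_le_exp (-volume.real B)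
    rw [measureReal_def] at *
    linarith
  have h2 := hindep.measure_inter_preimage_eq_mul Finset.univ (sets := fun _ => Bᶜ)
    fun _ _ => hB.compl
  simp only [Finset.mem_univ, Set.iInter_true] at h2
  rw [h2]
  refine (Finset.prod_le_prod' fun t _ => h1 t).trans_eq ?_
  rw [Finset.prod_const, Finset.card_univ, Fintype.card_fin, ← ENNReal.ofReal_pow
    (Real.exp_pos _).le, ← Real.exp_nat_mul, mul_neg]

/-! ### Covering the cube by enlarged cells -/

/-- Lower end of the interval of the points of `[0,1]` lying within `s` of the whole `j`-th cell of
the partition of `[0,1]` into `M` equal cells (shortened to length `s` at the two ends). -/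
def cellLo (s : ℝ) (M j : ℕ) : ℝ :=
  if j = 0 then 0 else if j + 1 = M then 1 - s else (j + 1) / M - s

/-- Upper end of the interval of the points of `[0,1]` lying within `s` of the whole `j`-th cell of
the partition of `[0,1]` into `M` equal cells (shortened to length `s` at the two ends). -/
def cellHi (s : ℝ) (M j : ℕ) : ℝ :=
  if j = 0 then s else if j + 1 = M then 1 else j / M + s

/-- The relative excess over `s` of the length of the interval `[cellLo s M j, cellHi s M j]`. -/
def cellGain (s : ℝ) (M j : ℕ) : ℝ :=
  if j = 0 then 0 else if j + 1 = M then 0 else 1 - 1 / (M * s)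

theorem cellHi_sub_cellLo {s : ℝ} (hs : 0 < s) {M : ℕ} (hM : 0 < M) (j : ℕ) :
    cellHi s M j - cellLo s M j = s * (1 + cellGain s M j) := by
  have hM' : (0 : ℝ) < M := by exact_mod_cast hM
  unfold cellHi cellLo cellGain
  split_ifs
  · ring
  · ring
  · field_simp
    ring

theorem cellGain_nonneg {s : ℝ} {M : ℕ} (h : 1 ≤ M * s) (j : ℕ) : 0 ≤ cellGain s M j := by
  unfold cellGain
  split_ifs
  · rfl
  · rfl
  · rw [sub_nonneg, div_le_one (by linarith)]
    exact h

theorem cellLo_nonneg {s : ℝ} {M : ℕ} (hs1 : s ≤ 1) (hM : 0 < M) (h2 : M * s ≤ 2) (j : ℕ) :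
    0 ≤ cellLo s M j := by
  have hM' : (0 : ℝ) < M := by exact_mod_cast hM
  unfold cellLo
  split_ifs with h0 h1
  · rfl
  · linarith
  · have : (1 : ℝ) ≤ j := by exact_mod_cast Nat.one_le_iff_ne_zero.2 h0
    rw [sub_nonneg, le_div_iff₀ hM']
    linarith

theorem cellHi_le_one {s : ℝ} {M : ℕ} (hs1 : s ≤ 1) (hM : 0 < M) (h2 : M * s ≤ 2) {j : ℕ}
    (hj : j < M) : cellHi s M j ≤ 1 := by
  have hM' : (0 : ℝ) < M := by exact_mod_cast hM
  unfold cellHi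
  split_ifs with h0 h1
  · exact hs1
  · rfl
  · have : (j : ℝ) + 2 ≤ M := by exact_mod_cast (by omega : j + 2 ≤ M)
    rw [← le_sub_iff_add_le, div_le_iff₀ hM']
    linarith

theorem abs_sub_le_of_mem_cell {s : ℝ} {M : ℕ} (hM : 0 < M) (h : 1 ≤ M * s) {j : ℕ} {y z : ℝ}
    (hy : y ∈ Set.Icc ((j : ℝ) / M) ((j + 1) / M))
    (hz : z ∈ Set.Icc (cellLo s M j) (cellHi s M j)) : |y - z| ≤ s := by
  have hM' : (0 : ℝ) < M := by exact_mod_cast hM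
  have hs : 1 / (M : ℝ) ≤ s := by rwa [div_le_iff₀ hM', mul_comm]
  obtain ⟨hy1, hy2⟩ := hy
  obtain ⟨hz1, hz2⟩ := hz
  rw [add_div] at hy2
  unfold cellLo at hz1
  unfold cellHi at hz2
  rw [abs_le]
  split_ifs at hz1 hz2 with h0 h1
  · subst h0
    simp only [Nat.cast_zero, zero_div, zero_add] at hy1 hy2
    constructor <;> linarith
  · have : (j : ℝ) / M + 1 / M = 1 := by
      rw [← add_div, div_eq_one_iff_eq hM'.ne']
      exact_mod_cast h1
    constructor <;> linarith
  · rw [add_div] at hz1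
    constructor <;> linarith

theorem exists_mem_cell {M : ℕ} (hM : 0 < M) {y : ℝ} (hy : y ∈ Set.Icc (0 : ℝ) 1) :
    ∃ j : Fin M, y ∈ Set.Icc ((j : ℝ) / M) ((j + 1) / M) := by
  have hM' : (0 : ℝ) < M := by exact_mod_cast hM
  have h0 : 0 ≤ y * M := mul_nonneg hy.1 hM'.le
  rcases lt_or_ge ⌊y * M⌋₊ M with h | h
  · refine ⟨⟨_, h⟩, ?_, ?_⟩
    · rw [div_le_iff₀ hM']
      exact Nat.floor_le h0
    · rw [le_div_iff₀ hM']
      exact (Nat.lt_floor_add_one _).le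
  · have h1 : (M : ℝ) ≤ y * M := (Nat.le_floor_iff h0).1 h
    refine ⟨⟨M - 1, by omega⟩, ?_, ?_⟩
    · rw [div_le_iff₀ hM']
      refine le_trans ?_ h1
      exact_mod_cast Nat.sub_le M 1
    · rw [le_div_iff₀ hM']
      have : ((M - 1 : ℕ) : ℝ) + 1 = M := by exact_mod_cast Nat.sub_add_cancel hM
      rw [this]
      nlinarith [hy.2]

/-- The product of the intervals `[cellLo s M (J i), cellHi s M (J i)]`. -/
def cellBox (s : ℝ) (M : ℕ) {d : ℕ} (J : Fin d → Fin M) : Set (EuclideanSpace ℝ (Fin d)) :=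
  euclideanBox (fun i => cellLo s M (J i)) (fun i => cellHi s M (J i))

theorem exists_norm_sub_le_of_cellBox {s : ℝ} {M d n : ℕ} (hs : 0 ≤ s) (hM : 0 < M)
    (h : 1 ≤ M * s) {x : Fin n → EuclideanSpace ℝ (Fin d)}
    (hx : ∀ J : Fin d → Fin M, ∃ t, x t ∈ cellBox s M J) :
    ∀ y ∈ unitCube d, ∃ t, ‖y - x t‖ ≤ s * √d := by
  intro y hy
  choose J hJ using fun i => exists_mem_cell hM (hy i)
  obtain ⟨t, ht⟩ := hx J
  refine ⟨t, ?_⟩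
  rw [EuclideanSpace.norm_eq, ← Real.sqrt_sq hs, ← Real.sqrt_mul (sq_nonneg s)]
  refine Real.sqrt_le_sqrt ?_
  have h1 : ∀ i ∈ Finset.univ, ‖(y - x t) i‖ ^ 2 ≤ s ^ 2 := fun i _ =>
    pow_le_pow_left₀ (norm_nonneg _) (abs_sub_le_of_mem_cell hM h (hJ i) (ht i)) 2
  refine (Finset.sum_le_sum h1).trans_eq ?_
  rw [Finset.sum_const, Finset.card_univ, Fintype.card_fin, nsmul_eq_mul, mul_comm]

/-- The M - 2 interior cells have gain u = 1 - N/M, so the claim is 2 + (M - 2)e^{-2u} ≤ N = M - Mu: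
the savings of the interior cells must pay for M - N. -/
theorem sum_exp_cellGain_le {N : ℝ} (hN : 9 < N) :
    ∑ j : Fin ⌈N⌉₊, Real.exp (-(2 * cellGain (1 / N) ⌈N⌉₊ j)) ≤ N := by
  set M := ⌈N⌉₊ with hM
  have hNM : N ≤ M := Nat.le_ceil N
  have hMN : (M : ℝ) < N + 1 := Nat.ceil_lt_add_one (by linarith)
  have hM10 : 10 ≤ M := Nat.lt_ceil.2 (by exact_mod_cast hN)
  have hM10' : (10 : ℝ) ≤ M := by exact_mod_cast hM10
  have hM0 : (0 : ℝ) < M := by linarith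
  set u : ℝ := 1 - 1 / (M * (1 / N)) with hu
  have hu1 : M * u = M - N := by
    rw [hu]
    field_simp
  have hu0 : 0 ≤ u := by nlinarith
  have hu2 : u ≤ 1 / 10 := by nlinarith
  set q := Real.exp (-(2 * u)) with hq
  have hterm : ∀ j : Fin M, Real.exp (-(2 * cellGain (1 / N) M j)) ≤
      q + ((if j = ⟨0, by omega⟩ then 1 - q else 0) +
        if j = ⟨M - 1, by omega⟩ then 1 - q else 0) := by
    intro j
    have hq1 : q ≤ 1 := Real.exp_le_one_iff.2 (by linarith)
    have e0 : j = ⟨0, by omega⟩ ↔ (j : ℕ) = 0 := Fin.ext_iff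
    have e1 : j = ⟨M - 1, by omega⟩ ↔ (j : ℕ) + 1 = M := by rw [Fin.ext_iff]; simp only; omega
    simp only [e0, e1, cellGain, ← hu]
    split_ifs <;> simp only [← hq, mul_zero, neg_zero, Real.exp_zero] <;> linarith
  refine (Finset.sum_le_sum fun j _ => hterm j).trans ?_
  rw [Finset.sum_add_distrib, Finset.sum_add_distrib, Finset.sum_ite_eq', Finset.sum_ite_eq',
    if_pos (Finset.mem_univ _), if_pos (Finset.mem_univ _), Finset.sum_const, Finset.card_univ,
    Fintype.card_fin, nsmul_eq_mul]
  have hq2 : q * (1 + 2 * u) ≤ 1 := by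
    have h1 : 1 + 2 * u ≤ Real.exp (2 * u) := by linarith [Real.add_one_le_exp (2 * u)]
    calc q * (1 + 2 * u) ≤ q * Real.exp (2 * u) := by gcongr
      _ = 1 := by rw [hq, ← Real.exp_add]; simp
  -- From `hq2`, 1 - q ≥ 2u/(1 + 2u), and u ≤ 1/10. Then (M - 2)(5/3)u ≥ Mu, as M ≥ 5.
  have hq3 : 5 / 3 * u ≤ 1 - q := by
    have hq0 : 0 < q := Real.exp_pos _
    nlinarith
  nlinarith

theorem one_add_sum_le_prod {ι : Type*} (S : Finset ι) {g : ι → ℝ} (hg : ∀ i, 0 ≤ g i) :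
    1 + ∑ i ∈ S, g i ≤ ∏ i ∈ S, (1 + g i) := by
  classical
  induction S using Finset.induction_on with
  | empty => simp
  | insert a S ha ih =>
    rw [Finset.sum_insert ha, Finset.prod_insert ha]
    have h1 : 0 ≤ ∑ i ∈ S, g i := Finset.sum_nonneg fun i _ => hg i
    have h2 : (1 + g a) * (1 + ∑ i ∈ S, g i) ≤ (1 + g a) * ∏ i ∈ S, (1 + g i) :=
      mul_le_mul_of_nonneg_left ih (by linarith [hg a])
    nlinarith [mul_nonneg (hg a) h1]

theorem sum_exp_volume_cellBox_le {N δ : ℝ} (hN : 9 < N) (hδ : 0 < δ) (hδ1 : δ < 1) {d n : ℕ}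
    (hd : 1 ≤ d) (hn : N ^ d * Real.log (N ^ d / δ) ≤ n) :
    ∑ J : Fin d → Fin ⌈N⌉₊, Real.exp (-(n * volume.real (cellBox (1 / N) ⌈N⌉₊ J))) ≤ δ := by
  have hN0 : 0 < N := by linarith
  have hNd : 0 < N ^ d := pow_pos hN0 d
  have hM0 : 0 < ⌈N⌉₊ := Nat.ceil_pos.2 hN0
  have hNM : 1 ≤ (⌈N⌉₊ : ℝ) * (1 / N) := by
    rw [mul_one_div, one_le_div hN0]
    exact Nat.le_ceil N
  set g : Fin ⌈N⌉₊ → ℝ := fun j => cellGain (1 / N) ⌈N⌉₊ j with hg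
  have hg0 : ∀ j, 0 ≤ g j := fun j => cellGain_nonneg hNM j
  have hvol : ∀ J : Fin d → Fin ⌈N⌉₊, volume.real (cellBox (1 / N) ⌈N⌉₊ J) =
      (1 / N) ^ d * ∏ i, (1 + g (J i)) := by
    intro J
    rw [measureReal_def, cellBox, volume_euclideanBox, ENNReal.toReal_prod]
    simp only [cellHi_sub_cellLo (one_div_pos.2 hN0) hM0]
    rw [Finset.prod_congr rfl fun i _ => ENNReal.toReal_ofReal
      (mul_nonneg (one_div_pos.2 hN0).le (add_nonneg zero_le_one (hg0 (J i)))),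
      Finset.prod_mul_distrib, Finset.prod_const, Finset.card_univ, Fintype.card_fin]
  set L := Real.log (N ^ d / δ) with hL
  -- This is where N > 9 ≥ e² enters: L ≥ 2 turns the gains in the exponent into the factors
  -- e^{-2g}, and the sum over J then factors into a d-th power.
  have hL2 : 2 ≤ L := by
    rw [hL, Real.le_log_iff_exp_le (by positivity)]
    have h1 : Real.exp 2 ≤ 9 := by
      have h2 : Real.exp 2 = Real.exp 1 ^ 2 := by rw [← Real.exp_nat_mul]; norm_num
      rw [h2]
      calc Real.exp 1 ^ 2 ≤ 3 ^ 2 :=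
            pow_le_pow_left₀ (Real.exp_pos _).le (by linarith [Real.exp_one_lt_d9]) 2
        _ = 9 := by norm_num
    have h3 : N ≤ N ^ d := le_self_pow₀ (by linarith) (by omega)
    have h4 : N ^ d ≤ N ^ d / δ := le_div_self hNd.le hδ hδ1.le
    linarith
  have hterm : ∀ J : Fin d → Fin ⌈N⌉₊,
      Real.exp (-(n * volume.real (cellBox (1 / N) ⌈N⌉₊ J))) ≤
        Real.exp (-L) * ∏ i, Real.exp (-(2 * g (J i))) := by
    intro J
    rw [← Real.exp_sum, ← Real.exp_add, Real.exp_le_exp, hvol, Finset.sum_neg_distrib,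
      ← Finset.mul_sum]
    have h1 := one_add_sum_le_prod Finset.univ fun i => hg0 (J i)
    have h2 : 0 ≤ ∑ i, g (J i) := Finset.sum_nonneg fun i _ => hg0 (J i)
    have h3 : L ≤ n * (1 / N) ^ d := by
      rw [one_div, inv_pow, ← div_eq_mul_inv, le_div_iff₀ hNd, mul_comm]
      exact hn
    have h4 : L * (1 + ∑ i, g (J i)) ≤ n * (1 / N) ^ d * ∏ i, (1 + g (J i)) :=
      mul_le_mul h3 h1 (by linarith) (by linarith)
    nlinarith [mul_le_mul_of_nonneg_right hL2 h2]
  refine (Finset.sum_le_sum fun J _ => hterm J).trans ?_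
  rw [← Finset.mul_sum, ← Fintype.sum_pow fun j => Real.exp (-(2 * g j))]
  have h5 : Real.exp (-L) = δ / N ^ d := by
    rw [hL, Real.exp_neg, Real.exp_log (by positivity), inv_div]
  rw [h5, div_mul_eq_mul_div, div_le_iff₀ hNd]
  exact mul_le_mul_of_nonneg_left (pow_le_pow_left₀
    (Finset.sum_nonneg fun j _ => (Real.exp_pos _).le) (sum_exp_cellGain_le hN) d) hδ.le

theorem cellBox_subset_unitCube {N : ℝ} (hN : 9 < N) {d : ℕ} (J : Fin d → Fin ⌈N⌉₊) :
    cellBox (1 / N) ⌈N⌉₊ J ⊆ unitCube d := by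
  have hN0 : 0 < N := by linarith
  have h1 : 1 / N ≤ 1 := by rw [div_le_one hN0]; linarith
  have h2 : (⌈N⌉₊ : ℝ) * (1 / N) ≤ 2 := by
    rw [mul_one_div, div_le_iff₀ hN0]
    linarith [Nat.ceil_lt_add_one hN0.le]
  exact fun y hy i => ⟨(cellLo_nonneg h1 (Nat.ceil_pos.2 hN0) h2 _).trans (hy i).1,
    (hy i).2.trans (cellHi_le_one h1 (Nat.ceil_pos.2 hN0) h2 (J i).2)⟩

/-- Enough independent uniform points are pairwise distinct and `√d / N`-dense in the unit cube
with high probability. -/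
theorem exists_event_injective_and_dense {Ω : Type*} [MeasurableSpace Ω] (P : Measure Ω)
    [IsProbabilityMeasure P] {d n : ℕ} (hd : 1 ≤ d) {x : Fin n → Ω → EuclideanSpace ℝ (Fin d)}
    (hmeas : ∀ t, Measurable (x t)) (hindep : iIndepFun x P)
    (hunif : ∀ t, pdf.IsUniform (x t) (unitCube d) P volume) {N δ : ℝ} (hN : 9 < N)
    (hδ : 0 < δ) (hδ1 : δ < 1) (hn : N ^ d * Real.log (N ^ d / δ) ≤ n) :
    ∃ E : Set Ω, MeasurableSet E ∧ P E ≥ ENNReal.ofReal (1 - δ) ∧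
      ∀ ω ∈ E, Function.Injective (fun t => x t ω) ∧
        ∀ y ∈ unitCube d, ∃ t, ‖y - x t ω‖ ≤ 1 / N * √d := by
  have hN0 : 0 < N := by linarith
  obtain ⟨hm, h0⟩ := measurableSet_injective_and_ae_injective P hd hmeas hindep hunif
  have hBm : ∀ J : Fin d → Fin ⌈N⌉₊, MeasurableSet (cellBox (1 / N) ⌈N⌉₊ J) := fun J =>
    (isClosed_euclideanBox _ _).measurableSet
  have hmE : MeasurableSet ({ω | Function.Injective fun t => x t ω} ∩
      ⋂ J : Fin d → Fin ⌈N⌉₊, ⋃ t, x t ⁻¹' cellBox (1 / N) ⌈N⌉₊ J) :=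
    hm.inter (MeasurableSet.iInter fun J => MeasurableSet.iUnion fun t => hmeas t (hBm J))
  refine ⟨_, hmE, ?_, fun ω hω => ⟨hω.1, ?_⟩⟩
  -- Union bound over the boxes containing no sample; collisions cost nothing.
  · have h1 : P ({ω | Function.Injective fun t => x t ω} ∩
        ⋂ J : Fin d → Fin ⌈N⌉₊, ⋃ t, x t ⁻¹' cellBox (1 / N) ⌈N⌉₊ J)ᶜ ≤ ENNReal.ofReal δ := by
      rw [Set.compl_inter, Set.compl_iInter]
      refine (measure_union_le _ _).trans ?_
      rw [h0, zero_add]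
      refine (measure_iUnion_fintype_le _ _).trans ?_
      refine le_trans (Finset.sum_le_sum fun J _ => ?_) ((ENNReal.ofReal_sum_of_nonneg
        fun J _ => (Real.exp_pos _).le).symm.trans_le (ENNReal.ofReal_le_ofReal
          (sum_exp_volume_cellBox_le hN hδ hδ1 hd hn)))
      rw [Set.compl_iUnion]
      exact measure_iInter_preimage_compl_le P hindep hunif (hBm J) (cellBox_subset_unitCube hN J)
    rw [← compl_compl ({ω | Function.Injective fun t => x t ω} ∩ _), prob_compl_eq_one_sub hmE.compl,
      ENNReal.ofReal_sub _ hδ.le, ENNReal.ofReal_one]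
    exact tsub_le_tsub_left h1 _
  · refine exists_norm_sub_le_of_cellBox (one_div_pos.2 hN0).le (Nat.ceil_pos.2 hN0) ?_ fun J =>
      Set.mem_iUnion.1 (Set.mem_iInter.1 hω.2 J)
    rw [mul_one_div, one_le_div hN0]
    exact Nat.le_ceil N

end RandomSampling

end

/-! ### Choice of the mesh and conclusion -/

theorem mainTheorem9 {Ω : Type*} [MeasurableSpace Ω] (P : Measure Ω) [IsProbabilityMeasure P]
    (d m n : ℕ) (hd : 1 ≤ d) (hn : 1 ≤ n)
    (x : Fin n → Ω → EuclideanSpace ℝ (Fin d))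
    (hmeas : ∀ t, Measurable (x t))
    (hindep : iIndepFun x P)
    (hunif : ∀ t, pdf.IsUniform (x t) (RandomSampling.unitCube d) P volume)
    (γ δ : ℝ) (hγ : γ ∈ Set.Ioo (0 : ℝ) 1) (hδ : δ ∈ Set.Ioo (0 : ℝ) 1)
    (hsize : (n : ℝ) ≥ (2 * Real.pi * d / (γ * Real.log 2)) ^ d * (m : ℝ) ^ d *
      Real.log ((2 * Real.pi * d / (γ * Real.log 2)) ^ d * ((m : ℝ) ^ d / δ))) :
    ∃ E : Set Ω, MeasurableSet E ∧ P E ≥ ENNReal.ofReal (1 - δ) ∧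
      ∀ ω ∈ E,
        0 < RandomSampling.lambdaMin (RandomSampling.weightedMatrix_isHermitian
          (RandomSampling.cubeFrequencies d m) (fun t => x t ω)) ∧
        RandomSampling.conditionNumber (RandomSampling.weightedMatrix_isHermitian
          (RandomSampling.cubeFrequencies d m) (fun t => x t ω)) ≤
            (1 - (2 : ℝ) ^ (γ - 1)) ^ (-2 : ℤ) := by
  obtain ⟨hγ0, hγ1⟩ := hγ
  obtain ⟨hδ0, hδ1⟩ := hδ
  have hlog : 0 < Real.log 2 := Real.log_pos one_lt_two
  have hγl : 0 < γ * Real.log 2 := mul_pos hγ0 hlog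
  have hpi := Real.pi_pos
  rcases Nat.eq_zero_or_pos m with rfl | hm
  -- For m = 0 no density is needed: any κ > 0 is admissible, so r may be large enough for one
  -- sample to cover the cube, and κ is solved from 2πrκ = γ ln 2.
  · obtain ⟨hmE, h0⟩ := RandomSampling.measurableSet_injective_and_ae_injective P hd hmeas hindep
      hunif
    refine ⟨_, hmE, ?_, fun ω hω => ?_⟩
    · rw [(prob_compl_eq_zero_iff hmE).1 h0]
      exact ENNReal.ofReal_le_one.2 (by linarith)
    · obtain ⟨r, hr⟩ := (RandomSampling.isCompact_unitCube d).isBounded.subset_ball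
        (x ⟨0, hn⟩ ω)
      have hr0 : 0 < max r 1 := lt_max_of_lt_right one_pos
      refine RandomSampling.conditionNumber_weightedMatrix_le hn hω hγ1 hr0
        (κ := γ * Real.log 2 / (2 * Real.pi * max r 1)) (by positivity) ?_
        (fun y hy => ⟨⟨0, hn⟩, ?_⟩) (by field_simp)
      · rw [Nat.cast_zero, zero_mul]
        positivity
      · rw [← dist_eq_norm]
        exact (Metric.mem_ball.1 (hr hy)).le.trans (le_max_left _ _)
  · have hm1 : (1 : ℝ) ≤ m := by exact_mod_cast hm
    have hd1 : (1 : ℝ) ≤ d := by exact_mod_cast hd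
    set N : ℝ := 2 * Real.pi * d / (γ * Real.log 2) * m with hN
    have hN9 : 9 < N := by
      have h1 : 9 * (γ * Real.log 2) < 2 * Real.pi := by
        have h2 : γ * Real.log 2 ≤ Real.log 2 := mul_le_of_le_one_left hlog.le hγ1.le
        linarith [Real.pi_gt_d2, Real.log_two_lt_d9]
      have h3 : 2 * Real.pi ≤ 2 * Real.pi * d * m := by
        rw [mul_assoc]
        exact le_mul_of_one_le_right (by positivity) (one_le_mul_of_one_le_of_one_le hd1 hm1)
      rw [hN, div_mul_eq_mul_div, lt_div_iff₀ hγl]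
      linarith
    have hN0 : 0 < N := by linarith
    obtain ⟨E, hE, hPE, h⟩ := RandomSampling.exists_event_injective_and_dense P hd hmeas hindep
      hunif hN9 hδ0 hδ1 (by rwa [← mul_div_assoc, ← mul_pow, ← hN] at hsize)
    refine ⟨E, hE, hPE, fun ω hω => ?_⟩
    -- With r = √d/N and κ = m√d, 2πrκ = 2πdm/N = γ ln 2.
    refine RandomSampling.conditionNumber_weightedMatrix_le hn (h ω hω).1 hγ1
      (r := 1 / N * √d) (κ := m * √d) (by positivity) (by positivity) le_rfl (h ω hω).2 ?_
    have hdd : √(d : ℝ) * √d = d := Real.mul_self_sqrt (by positivity)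
    calc _ = 2 * Real.pi * (1 / N) * m * (√(d : ℝ) * √d) := by ring
      _ = _ := by
        rw [hdd, hN]
        field_simp
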